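/- Theorem 6 (Sharkovsky). Order the positive integers by Sharkovsky's ordering $$3 \prec 5 \prec 7 \prec \cdots \prec 2\cdot 3 \prec 2\cdot 5 \prec 2\cdot 7 \prec \cdots \prec 2^2\cdot 3 \prec 2^2\cdot 5 \prec 2^2\cdot 7 \prec \cdots \prec 2^3 \prec 2^2 \prec 2 \prec 1,$$ and write $m \preceq n$ for "$m = n$ or $m \prec n$". A point $y$ has least period $n \ge 1$ under $f$ if $f^n(y) = y$ and $f^i(y) \ne y$ for $0 < i < n$; its orbit $\{f^i(y) : i \ge 0\}$ is then called a period-$n$ orbit of $f$. The periods of $f$ are the least periods of its periodic points. (1) Let $f : I \to I$ be a continuous self-map of a compact interval $I$ (nonempty) with a point of least period $m$. Then $f$ has a point of least period $n$ for every $n$ with $m \prec n$. Moreover, if $I$ has more than one point, then for all $m, n \ge 1$, every continuous $f : I \to I$ that has a point of least period $m$ has a point of least period $n$ if and only if $m \preceq n$. (2) Conversely, for every compact interval $I$ with more than one point and every tail $S$ of the ordering (a nonempty set of positive integers such that $m \in S$ and $m \prec n$ imply $n \in S$), there is a continuous $f : I \to I$ whose set of periods is exactly $S$. (3) Explicitly,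 let $T(x) = 1 - |2x - 1|$ be the tent map on $[0,1]$, and for $0 \le c \le d \le 1$ let the truncation of $T$ to $[c,d]$ be the continuous map $x \mapsto \max(c, \min(d, T(x)))$ of $[0,1]$ into itself. For every $k \ge 1$ there is a period-$k$ orbit $P_k$ of $T$ of smallest diameter $\max P_k - \min P_k$ among the period-$k$ orbits of $T$; and for every such $P_k$ the set of periods of the truncation $T_k$ of $T$ to $[\min P_k, \max P_k]$ is exactly $\{n : k \preceq n\}$. (4) There are sets $Q_3, Q_6, Q_{12}, \dots$ such that $Q_3$ is a period-$3$ orbit of $T$ of smallest diameter and, for each $i \ge 0$, $Q_{2^{i+1}\cdot 3}$ has the smallest diameter among the period-$(2^{i+1}\cdot 3)$ orbits of $T$ contained in $[\min Q_{2^i \cdot 3}, \max Q_{2^i\cdot 3}]$. For every such sequence, with $q_0 = \sup_i \min Q_{2^i\cdot 3}$ and $q_1 = \inf_i \max Q_{2^i\cdot 3}$, the set of periods of the truncation $T_\infty$ of $T$ to $[q_0, q_1]$ is exactly $\{2^i : i \ge 0\}$. -/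

import Mathlib

namespace Sharkovsky

/-- Sharkovsky's (strict) ordering `m ≺ n` of the positive integers:
`3 ≺ 5 ≺ 7 ≺ ⋯ ≺ 2·3 ≺ 2·5 ≺ 2·7 ≺ ⋯ ≺ 2²·3 ≺ 2²·5 ≺ ⋯ ≺ 2³ ≺ 2² ≺ 2 ≺ 1`.
Every positive integer is uniquely `2 ^ a * p` with `p` odd. -/
def Prec (m n : ℕ) : Prop :=
  ∃ a p b q : ℕ, Odd p ∧ Odd q ∧ m = 2 ^ a * p ∧ n = 2 ^ b * q ∧
    ((1 < p ∧ 1 < q ∧ (a < b ∨ (a = b ∧ p < q))) ∨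
      (1 < p ∧ q = 1) ∨
      (p = 1 ∧ q = 1 ∧ b < a))

/-- The reflexive version `m ≼ n` of Sharkovsky's ordering. -/
def PrecEq (m n : ℕ) : Prop := m = n ∨ Prec m n

/-- A tail of Sharkovsky's ordering: a nonempty set of positive integers that contains, with
each of its elements, every later one. -/
def IsTail (S : Set ℕ) : Prop :=
  S.Nonempty ∧ (∀ n ∈ S, 0 < n) ∧ ∀ m ∈ S, ∀ n : ℕ, Prec m n → n ∈ S

/-- The set of `n ≥ 1` such that `f` has a point of least period `n`
(`Function.minimalPeriod` is `0` at points that are not periodic). -/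
def periods {α : Type*} (f : α → α) : Set ℕ :=
  {n | 0 < n ∧ ∃ x : α, Function.minimalPeriod f x = n}

/-- `P` is a period-`n` orbit of `f`: the orbit `{f^k(y) | k ≥ 0}` of a point `y` of least
period `n ≥ 1`. -/
def IsPeriodicOrbit {α : Type*} (f : α → α) (n : ℕ) (P : Set α) : Prop :=
  0 < n ∧ ∃ y : α, Function.minimalPeriod f y = n ∧ P = Set.range (fun k : ℕ => f^[k] y)

/-- The tent map `T(x) = 1 - |2x - 1|` of `[0, 1]`. -/
def tent (x : Set.Icc (0 : ℝ) 1) : Set.Icc (0 : ℝ) 1 :=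
  ⟨1 - |2 * (x : ℝ) - 1|, by
    have h0 := x.2.1
    have h1 := x.2.2
    have h : |2 * (x : ℝ) - 1| ≤ 1 := abs_le.mpr ⟨by linarith, by linarith⟩
    exact ⟨by linarith, by linarith [abs_nonneg (2 * (x : ℝ) - 1)]⟩⟩

/-- The tent map truncated at the heights `lo ≤ hi`: its value at `x` is `lo` if `T x ≤ lo`,
`hi` if `T x ≥ hi`, and `T x` otherwise. -/
noncomputable def truncTent (lo hi : Set.Icc (0 : ℝ) 1) (x : Set.Icc (0 : ℝ) 1) :
    Set.Icc (0 : ℝ) 1 :=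
  max lo (min hi (tent x))

/-- The diameter `max P - min P` of a (finite nonempty) set `P ⊆ [0, 1]`. Here `sSup` and
`sInf` are those of the complete lattice `[0, 1]`; on finite nonempty sets they are the
maximum and the minimum. -/
noncomputable def diam (P : Set (Set.Icc (0 : ℝ) 1)) : ℝ :=
  ((sSup P : Set.Icc (0 : ℝ) 1) : ℝ) - ((sInf P : Set.Icc (0 : ℝ) 1) : ℝ)

/-- `P` is a period-`n` orbit of the tent map that lies in `A` and has the smallest diameter
among all period-`n` orbits of the tent map that lie in `A`. -/
def IsSmallestOrbitIn (A : Set (Set.Icc (0 : ℝ) 1)) (n : ℕ) (P : Set (Set.Icc (0 : ℝ) 1)) :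
    Prop :=
  IsPeriodicOrbit tent n P ∧ P ⊆ A ∧
    ∀ R : Set (Set.Icc (0 : ℝ) 1), IsPeriodicOrbit tent n R → R ⊆ A → diam P ≤ diam R

/-- `Q 0, Q 1, Q 2, …` are nested choices of period-`3`, `6`, `12`, … orbits of the tent map:
`Q 0` has the smallest diameter among the period-`3` orbits, and `Q (i + 1)` has the smallest
diameter among the period-`2 ^ (i + 1) * 3` orbits in `[min (Q i), max (Q i)]`. -/
def IsNestedChoice (Q : ℕ → Set (Set.Icc (0 : ℝ) 1)) : Prop :=
  IsSmallestOrbitIn Set.univ 3 (Q 0) ∧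
    ∀ i : ℕ, IsSmallestOrbitIn (Set.Icc (sInf (Q i)) (sSup (Q i))) (2 ^ (i + 1) * 3) (Q (i + 1))

/-- The limiting truncation, at the heights `sup_i min (Q i)` and `inf_i max (Q i)`. -/
noncomputable def limTent (Q : ℕ → Set (Set.Icc (0 : ℝ) 1)) :
    Set.Icc (0 : ℝ) 1 → Set.Icc (0 : ℝ) 1 :=
  truncTent (⨆ i, sInf (Q i)) (⨅ i, sSup (Q i))

end Sharkovsky

/-! ### Covering relations and the periods they force. -/

namespace Sharkovsky

open Set Function

/-! ### Loops of intervals -/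

/-! Forcing. If each interval of a closed chain lies in the image of the one before it, some
periodic point follows the chain (`exists_follows_loop`), so periods can be read off from covering
relations. Every cycle with at least two points has neighbours `a < b` with `b ≤ f a` and `f b ≤ a`,
around a fixed point `c`. Either all points of the cycle jump across `c`, or a twist produces loops
of every even length (`IsCycle.switch_or_even`). A cycle of odd length greater than 1 cannot be
split evenly by `c`, so it forces all even periods. The least odd period greater than 1 also forces
every larger odd one, because the increasing images of `[a, b]` absorb the whole cycle
(`odd_mem_periods_of_cover`). Applying this to the iterates `f^[2 ^ a]` gives the full ordering
(`mem_periods_of_prec`).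

Sharpness. An orbit of a truncated tent map that avoids both truncation heights is an orbit of the
tent map strictly between them. Truncate at the ends of a shortest period-`k` orbit. Another orbit
whose period precedes `k` would lie strictly inside, and would itself force a still shorter
period-`k` orbit (`periods_truncTent`). For the limiting truncation the same argument shows that
each orbit whose period is not a power of two contains one of the two heights. One such period would
force infinitely many by doubling, and two points cannot meet three disjoint orbits
(`periods_limTent`). -/

lemma exists_uIcc_mapsTo {f : ℝ → ℝ} (hf : Continuous f) (p q : ℝ) :
    ∃ p' ∈ uIcc p q, ∃ q' ∈ uIcc p q, f p' = f p ∧ f q' = f q ∧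
      ∀ t ∈ uIcc p' q', f t ∈ uIcc (f p) (f q) := by
  -- Take a closest pair in the hull with the prescribed images. If `f` left the hull of these
  -- images at some `t` between them, the intermediate value theorem would give a closer pair.
  let S : Set (ℝ × ℝ) := (uIcc p q ×ˢ uIcc p q) ∩ {z | f z.1 = f p ∧ f z.2 = f q}
  have hS : IsCompact S := by
    refine (isCompact_uIcc.prod isCompact_uIcc).inter_right ?_
    exact (isClosed_eq (by fun_prop) (by fun_prop)).inter
      (isClosed_eq (by fun_prop) (by fun_prop))
  have hne : S.Nonempty := ⟨(p, q), ⟨left_mem_uIcc, right_mem_uIcc⟩, rfl, rfl⟩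
  obtain ⟨⟨x, y⟩, ⟨⟨hx, hy⟩, hfx, hfy⟩, hmin⟩ :=
    hS.exists_isMinOn hne (f := fun z : ℝ × ℝ => |z.1 - z.2|) (by fun_prop)
  simp only at hx hy hfx hfy
  refine ⟨x, hx, y, hy, hfx, hfy, fun t ht => ?_⟩
  have hsub : uIcc x y ⊆ uIcc p q := uIcc_subset_uIcc hx hy
  by_contra hcon
  have key : f q ∈ uIcc (f x) (f t) ∨ f p ∈ uIcc (f t) (f y) := by
    rw [hfx, hfy]
    simp only [mem_uIcc] at hcon ⊢
    grind
  rcases key with h | h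
  · obtain ⟨y', hy', hfy'⟩ := intermediate_value_uIcc hf.continuousOn h
    have h1 : y' ∈ uIcc x y := uIcc_subset_uIcc_left ht hy'
    have h2 : |x - y| ≤ |x - y'| := hmin (show (x, y') ∈ S from ⟨⟨hx, hsub h1⟩, hfx, hfy'⟩)
    have : t = y := by
      rw [mem_uIcc] at ht hy'
      grind
    exact hcon (by rw [this, hfy]; exact right_mem_uIcc)
  · obtain ⟨x', hx', hfx'⟩ := intermediate_value_uIcc hf.continuousOn h
    have h1 : x' ∈ uIcc x y := uIcc_subset_uIcc_right ht hx'
    have h2 : |x - y| ≤ |x' - y| := hmin (show (x', y) ∈ S from ⟨⟨hsub h1, hy⟩, hfx', hfy⟩)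
    have : t = x := by
      rw [mem_uIcc] at ht hx'
      grind
    exact hcon (by rw [this, hfx]; exact left_mem_uIcc)

/-- A segment is pulled back along the chain one step at a time, shrunk by `exists_uIcc_mapsTo` so
that its image never overshoots. Only the end values `r`, `s` are prescribed, so the `K i` need not
be compact. -/
lemma exists_uIcc_follows {f : ℝ → ℝ} (hf : Continuous f) (K : ℕ → Set ℝ)
    (hK : ∀ i, (K i).OrdConnected) (n : ℕ) (hc : ∀ i < n, K (i + 1) ⊆ f '' K i) :
    ∀ r ∈ K n, ∀ s ∈ K n, ∃ p ∈ K 0, ∃ q ∈ K 0, f^[n] p = r ∧ f^[n] q = s ∧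
      ∀ t ∈ uIcc p q, f^[n] t ∈ uIcc r s ∧ ∀ i ≤ n, f^[i] t ∈ K i := by
  induction n with
  | zero =>
    intro r hr s hs
    refine ⟨r, hr, s, hs, rfl, rfl, fun t ht => ⟨ht, fun i hi => ?_⟩⟩
    obtain rfl : i = 0 := by omega
    exact (hK 0).uIcc_subset hr hs ht
  | succ n ih =>
    intro r hr s hs
    obtain ⟨r', hr', rfl⟩ := hc n (by omega) hr
    obtain ⟨s', hs', rfl⟩ := hc n (by omega) hs
    obtain ⟨r₁, hr₁, s₁, hs₁, hfr, hfs, hmaps⟩ := exists_uIcc_mapsTo hf r' s'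
    have hsub := (hK n).uIcc_subset hr' hs'
    obtain ⟨p, hp, q, hq, hfp, hfq, hpq⟩ :=
      ih (fun i hi => hc i (by omega)) r₁ (hsub hr₁) s₁ (hsub hs₁)
    refine ⟨p, hp, q, hq, ?_, ?_, fun t ht => ?_⟩
    · rw [iterate_succ_apply', hfp, hfr]
    · rw [iterate_succ_apply', hfq, hfs]
    · have h1 : f^[n + 1] t ∈ uIcc (f r') (f s') := by
        rw [iterate_succ_apply']
        exact hmaps _ (hpq t ht).1
      refine ⟨h1, fun i hi => ?_⟩
      rcases Nat.lt_or_ge i (n + 1) with h | h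
      · exact (hpq t ht).2 i (by omega)
      · obtain rfl : i = n + 1 := by omega
        exact (hK _).uIcc_subset hr hs h1

/-- A loop of intervals, each covering the next, is followed by a periodic point. -/
lemma exists_follows_loop {f : ℝ → ℝ} (hf : Continuous f) (K : ℕ → Set ℝ)
    (hK : ∀ i, (K i).OrdConnected) (n : ℕ) (hc : ∀ i < n, K (i + 1) ⊆ f '' K i)
    {α β : ℝ} (h0 : K 0 = uIcc α β) (hn : K n = uIcc α β) :
    ∃ x, f^[n] x = x ∧ ∀ i ≤ n, f^[i] x ∈ K i := by
  obtain ⟨p, hp, q, hq, hfp, hfq, hpq⟩ := exists_uIcc_follows hf K hK n hc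
    (min α β) (hn ▸ ⟨le_rfl, min_le_max⟩) (max α β) (hn ▸ ⟨min_le_max, le_rfl⟩)
  rw [h0] at hp hq
  have hcont : Continuous (fun t => f^[n] t - t) := (hf.iterate n).sub continuous_id
  -- The ends `p`, `q` are sent to the two extremes of an interval containing them both, so `f^[n] t
  -- - t` changes sign.
  have h : (0 : ℝ) ∈ uIcc (f^[n] p - p) (f^[n] q - q) := by
    rw [hfp, hfq, mem_uIcc]
    exact Or.inl ⟨by linarith [hp.1], by linarith [hq.2]⟩
  obtain ⟨x, hx, hfx⟩ := intermediate_value_uIcc hcont.continuousOn h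
  exact ⟨x, by linarith [show f^[n] x - x = 0 from hfx], (hpq x hx).2⟩

lemma subset_image_uIcc {f : ℝ → ℝ} (hf : Continuous f) {s : Set ℝ} {p q : ℝ}
    (h : s ⊆ uIcc (f p) (f q)) : s ⊆ f '' uIcc p q :=
  h.trans (intermediate_value_uIcc hf.continuousOn)

lemma mem_periods_of_forall_lt {f : ℝ → ℝ} {n : ℕ} (hn : 0 < n) {x : ℝ} (hx : f^[n] x = x)
    (h : ∀ d, 0 < d → d < n → d ∣ n → minimalPeriod f x = d → False) : n ∈ periods f := by
  have hp : IsPeriodicPt f n x := hx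
  refine ⟨hn, x, ?_⟩
  have hd := hp.minimalPeriod_dvd
  rcases (Nat.le_of_dvd hn hd).lt_or_eq with hlt | heq
  · exact (h _ (hp.minimalPeriod_pos hn) hlt hd rfl).elim
  · exact heq

/-! ### Even periods -/

/-- Put `A = [u, v]`, `B = [v, c]`, `C = [c, w]`, in either orientation. Both `A` and `B` cover `C`,
while `C` covers `A` and `B`. The loop `A C B C ⋯ B C` has length `2 * j` and visits `A` only once.
-/
lemma even_mem_periods_of_twist {f : ℝ → ℝ} (hf : Continuous f) {u v w c : ℝ} (hc : f c = c)
    (huv : uIcc c w ⊆ uIcc (f u) (f v)) (hv : uIcc c w ⊆ uIcc (f v) c)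
    (hw : uIcc u c ⊆ uIcc c (f w)) (hvm : v ∈ uIcc u c)
    (hAC : ∀ x ∈ uIcc u v, x ∉ uIcc c w) (hfw : f w ∉ uIcc v c)
    (hfv : f v ∈ uIcc c w → f v = w) {j : ℕ} (hj : 0 < j) : 2 * j ∈ periods f := by
  classical
  let K : ℕ → Set ℝ := fun i =>
    if Odd i then uIcc c w else if i % (2 * j) = 0 then uIcc u v else uIcc v c
  have hK : ∀ i, (K i).OrdConnected := by
    intro i
    simp only [K]
    split_ifs <;> exact ordConnected_uIcc
  have hKodd : ∀ i, Odd i → K i = uIcc c w := fun i hi => by simp [K, hi]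
  have hKeven : ∀ i, ¬ Odd i → K i ⊆ uIcc u c := by
    intro i hi
    simp only [K, hi, if_false]
    split_ifs
    · exact uIcc_subset_uIcc_left hvm
    · exact uIcc_subset_uIcc_right hvm
  have hcov : ∀ i < 2 * j, K (i + 1) ⊆ f '' K i := by
    intro i _
    by_cases hi : Odd i
    · rw [hKodd i hi]
      refine (hKeven (i + 1) (by grind)).trans (subset_image_uIcc hf ?_)
      rwa [hc]
    · rw [hKodd (i + 1) (by grind)]
      simp only [K, hi, if_false]
      split_ifs
      · exact subset_image_uIcc hf huv
      · exact subset_image_uIcc hf (by rwa [hc])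
  obtain ⟨x, hx, hxK⟩ := exists_follows_loop hf K hK (2 * j) hcov (α := u) (β := v)
    (by simp [K]) (by simp [K])
  have hx0 : x ∈ uIcc u v := by simpa [K] using hxK 0 (by omega)
  refine mem_periods_of_forall_lt (by omega) hx fun d hd0 hdlt _ hdper => ?_
  have hfd : f^[d] x = x := hdper ▸ iterate_minimalPeriod
  have hxd := hxK d hdlt.le
  rw [hfd] at hxd
  -- An odd shorter period puts `x` in `A` and `C`, which are disjoint. An even one puts `x` in both
  -- `A` and `B`, so `x = v`; then `f v = w`, and `f w` lies outside `B`.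
  by_cases hdo : Odd d
  · rw [hKodd d hdo] at hxd
    exact hAC x hx0 hxd
  · have hxv : x = v := by
      simp only [K, hdo, if_false, Nat.mod_eq_of_lt hdlt, hd0.ne'] at hxd
      simp only [mem_uIcc] at hxd hx0 hvm
      grind
    have h1 := hxK 1 (by omega)
    rw [hKodd 1 (by decide)] at h1
    have h2 := hxK 2 (by grind)
    have hd2 : 2 < 2 * j := by grind
    simp only [K, Nat.mod_eq_of_lt hd2] at h2
    rw [if_neg (by decide), if_neg (by decide)] at h2
    simp only [iterate_succ, iterate_zero, comp_apply, id] at h1 h2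
    rw [hxv] at h1 h2
    rw [hfv h1] at h2
    exact hfw h2

/-! ### Cycles -/

/-- `P` is the underlying set of a periodic orbit of `f`. -/
def IsCycle (f : ℝ → ℝ) (P : Finset ℝ) : Prop :=
  P.Nonempty ∧ ∀ x ∈ P, f x ∈ P ∧ minimalPeriod f x = P.card ∧ ∀ y ∈ P, ∃ k < P.card, f^[k] x = y

lemma exists_isCycle {f : ℝ → ℝ} {m : ℕ} (hm : m ∈ periods f) :
    ∃ P, IsCycle f P ∧ P.card = m := by
  obtain ⟨hm0, x, hx⟩ := hm
  have hcard : ((Finset.range m).image (fun k => f^[k] x)).card = m := by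
    rw [Finset.card_image_of_injOn, Finset.card_range]
    intro i hi j hj hij
    simp only [Finset.coe_range, mem_Iio] at hi hj
    exact (iterate_eq_iterate_iff_of_lt_minimalPeriod (hx ▸ hi) (hx ▸ hj)).1 hij
  have hmem : ∀ k, f^[k] x ∈ (Finset.range m).image (fun k => f^[k] x) := fun k =>
    Finset.mem_image.2 ⟨k % m, Finset.mem_range.2 (Nat.mod_lt _ hm0), by
      rw [← hx]; exact iterate_mod_minimalPeriod_eq⟩
  have hxper : x ∈ periodicPts f := minimalPeriod_pos_iff_mem_periodicPts.1 (by omega)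
  refine ⟨_, ⟨⟨x, hmem 0⟩, fun y hy => ?_⟩, hcard⟩
  rw [hcard]
  obtain ⟨k, hk, rfl⟩ := Finset.mem_image.1 hy
  rw [Finset.mem_range] at hk
  refine ⟨?_, ?_, fun z hz => ?_⟩
  · have := hmem (k + 1)
    rwa [iterate_succ_apply'] at this
  · rw [minimalPeriod_apply_iterate hxper, hx]
  · obtain ⟨l, hl, rfl⟩ := Finset.mem_image.1 hz
    refine ⟨(l + (m - k)) % m, Nat.mod_lt _ hm0, ?_⟩
    have h1 : minimalPeriod f (f^[k] x) = m := by rw [minimalPeriod_apply_iterate hxper, hx]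
    have h2 := iterate_mod_minimalPeriod_eq (f := f) (x := f^[k] x) (n := l + (m - k))
    rw [h1] at h2
    rw [h2, ← iterate_add_apply, show l + (m - k) + k = l + m by omega, iterate_add_apply]
    congr 1
    rw [← hx]
    exact iterate_minimalPeriod

/-- A cycle has no proper nonempty invariant subset. -/
lemma IsCycle.eq_of_mapsTo {f : ℝ → ℝ} {P : Finset ℝ} (hP : IsCycle f P) {s : Set ℝ} {x : ℝ}
    (hx : x ∈ P) (hxs : x ∈ s) (hs : ∀ y ∈ P, y ∈ s → f y ∈ s) : ∀ y ∈ P, y ∈ s := by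
  have h : ∀ k, f^[k] x ∈ P ∧ f^[k] x ∈ s := by
    intro k
    induction k with
    | zero => exact ⟨hx, hxs⟩
    | succ k ih =>
      rw [iterate_succ_apply']
      exact ⟨(hP.2 _ ih.1).1, hs _ ih.1 ih.2⟩
  intro y hy
  obtain ⟨k, -, rfl⟩ := (hP.2 x hx).2.2 y hy
  exact (h k).2

lemma IsCycle.apply_ne {f : ℝ → ℝ} {P : Finset ℝ} (hP : IsCycle f P) (hm : 2 ≤ P.card) {x : ℝ}
    (hx : x ∈ P) : f x ≠ x := by
  intro h
  have h1 : minimalPeriod f x = 1 := minimalPeriod_eq_one_iff_isFixedPt.2 h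
  have h2 := (hP.2 x hx).2.1
  omega

/-- Two neighbouring points of a cycle, with a fixed point between them, are exchanged in
direction. -/
lemma IsCycle.exists_center {f : ℝ → ℝ} (hf : Continuous f) {P : Finset ℝ} (hP : IsCycle f P)
    (hm : 2 ≤ P.card) : ∃ a ∈ P, ∃ b ∈ P, ∃ c, a < c ∧ c < b ∧ f c = c ∧ b ≤ f a ∧ f b ≤ a ∧
      ∀ x ∈ P, x ≤ a ∨ b ≤ x := by
  have hne := fun x hx => hP.apply_ne hm (x := x) hx
  have hmin : P.min' hP.1 ∈ P.filter (fun x => x < f x) := by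
    have h1 := P.min'_mem hP.1
    refine Finset.mem_filter.2 ⟨h1, lt_of_le_of_ne (P.min'_le _ (hP.2 _ h1).1) (hne _ h1).symm⟩
  -- `a` is the last point of the cycle that moves right and `b` is its right neighbour, which must
  -- therefore move left.
  obtain ⟨a, ha, hamax⟩ := Finset.exists_max_image (P.filter (fun x => x < f x)) id ⟨_, hmin⟩
  obtain ⟨haP, haf⟩ := Finset.mem_filter.1 ha
  have hfa : f a ∈ P.filter (fun x => a < x) := Finset.mem_filter.2 ⟨(hP.2 a haP).1, haf⟩
  obtain ⟨b, hb, hbmin⟩ := Finset.exists_min_image (P.filter (fun x => a < x)) id ⟨_, hfa⟩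
  obtain ⟨hbP, hab⟩ := Finset.mem_filter.1 hb
  have hgap : ∀ x ∈ P, x ≤ a ∨ b ≤ x := fun x hx => (le_or_gt x a).imp_right fun h =>
    hbmin x (Finset.mem_filter.2 ⟨hx, h⟩)
  have hfb : f b < b := by
    rcases lt_or_gt_of_ne (hne b hbP) with h | h
    · exact h
    · exact absurd (hamax b (Finset.mem_filter.2 ⟨hbP, h⟩)) (not_le.2 hab)
  have h0 : (0 : ℝ) ∈ Icc (f b - b) (f a - a) := ⟨by linarith, by linarith⟩
  obtain ⟨c, hc, hfc⟩ := intermediate_value_Icc' hab.le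
    (f := fun x => f x - x) (by fun_prop) h0
  simp only at hfc
  refine ⟨a, haP, b, hbP, c, lt_of_le_of_ne hc.1 ?_, lt_of_le_of_ne hc.2 ?_, by linarith,
    hbmin _ hfa, (hgap _ (hP.2 b hbP).1).resolve_right (not_le.2 hfb), hgap⟩
  · rintro rfl; linarith
  · rintro rfl; linarith

lemma one_mem_periods {f : ℝ → ℝ} (hf : Continuous f) {m : ℕ} (hm : m ∈ periods f) :
    1 ∈ periods f := by
  obtain ⟨P, hP, hcard⟩ := exists_isCycle hm
  rcases Nat.lt_or_ge m 2 with h | h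
  · obtain rfl : m = 1 := by have := hm.1; omega
    exact hm
  · obtain ⟨a, -, b, -, c, -, -, hc, -⟩ := hP.exists_center hf (by omega)
    exact ⟨one_pos, c, minimalPeriod_eq_one_iff_isFixedPt.2 hc⟩

/-- Either all points of a cycle change sides about a fixed point next to which they are
exchanged, or all even numbers are periods. -/
lemma IsCycle.switch_or_even {f : ℝ → ℝ} (hf : Continuous f) {P : Finset ℝ} (hP : IsCycle f P)
    {a₀ b₀ c : ℝ} (ha₀ : a₀ ∈ P) (hb₀ : b₀ ∈ P) (hac : a₀ < c) (hcb : c < b₀) (hc : f c = c)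
    (hfa : b₀ ≤ f a₀) (hfb : f b₀ ≤ a₀) (hgap : ∀ x ∈ P, x ≤ a₀ ∨ b₀ ≤ x) :
    (∀ x ∈ P, x < c ↔ c < f x) ∨ ∀ j, 0 < j → 2 * j ∈ periods f := by
  classical
  -- The two alternatives are the twist of `even_mem_periods_of_twist` and its mirror image.
  by_cases hex : ∃ u v w, (u < v ∧ v < c ∧ c < w ∧ f w ≤ u ∧ w ≤ f v ∧ f u ≤ c) ∨
      (w < c ∧ c < v ∧ v < u ∧ u ≤ f w ∧ f v ≤ w ∧ c ≤ f u)
  · right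
    intro j hj
    obtain ⟨u, v, w, ⟨h1, h2, h3, h4, h5, h6⟩ | ⟨h1, h2, h3, h4, h5, h6⟩⟩ := hex
    all_goals
      refine even_mem_periods_of_twist hf (u := u) (v := v) (w := w) hc ?_ ?_ ?_ ?_ ?_ ?_ ?_ hj
      · intro x hx; rw [mem_uIcc] at *; grind
      · intro x hx; rw [mem_uIcc] at *; grind
      · intro x hx; rw [mem_uIcc] at *; grind
      · rw [mem_uIcc]; grind
      · intro x hx; rw [mem_uIcc] at *; grind
      · rw [mem_uIcc]; grind
      · rw [mem_uIcc]; grind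
  left
  push Not at hex
  have hPc : ∀ x ∈ P, x ≠ c := fun x hx h => by
    rcases hgap x hx with h' | h' <;> linarith
  -- Without a twist, grow an interval around `c` on which all points of the cycle switch sides, and
  -- whose two halves contain points mapped at least as far as its opposite ends.
  let S := (P ×ˢ P).filter fun z => z.1 < c ∧ c < z.2 ∧
    (∀ x ∈ P, z.1 ≤ x → x ≤ z.2 → (x < c ↔ c < f x)) ∧
    (∃ v ∈ P, z.1 ≤ v ∧ v < c ∧ z.2 ≤ f v) ∧ ∃ w ∈ P, c < w ∧ w ≤ z.2 ∧ f w ≤ z.1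
  have hS : (a₀, b₀) ∈ S := by
    refine Finset.mem_filter.2 ⟨Finset.mk_mem_product ha₀ hb₀, hac, hcb, fun x hx h1 h2 => ?_,
      ⟨a₀, ha₀, le_rfl, hac, hfa⟩, ⟨b₀, hb₀, hcb, le_rfl, hfb⟩⟩
    simp only at h1 h2
    rcases hgap x hx with h | h
    · obtain rfl : x = a₀ := le_antisymm h h1
      exact ⟨fun _ => hcb.trans_le hfa, fun _ => hac⟩
    · obtain rfl : x = b₀ := le_antisymm h2 h
      constructor <;> intro <;> linarith
  obtain ⟨⟨a, b⟩, hab, hmax⟩ := Finset.exists_max_image S (fun z => z.2 - z.1) ⟨_, hS⟩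
  obtain ⟨hmem, hac', hcb', hsw, ⟨v, hvP, hav, hvc, hbv⟩, w, hwP, hcw, hwb, hwa⟩ :=
    Finset.mem_filter.1 hab
  obtain ⟨haP, hbP⟩ := Finset.mem_product.1 hmem
  simp only at haP hbP hac' hcb' hsw hav hbv hwb hwa hmax
  obtain ⟨w', hw', hw'min⟩ := Finset.exists_min_image (P.filter fun x => c < x ∧ x ≤ b) f
    ⟨w, Finset.mem_filter.2 ⟨hwP, hcw, hwb⟩⟩
  obtain ⟨v', hv', hv'max⟩ := Finset.exists_max_image (P.filter fun x => a ≤ x ∧ x < c) f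
    ⟨v, Finset.mem_filter.2 ⟨hvP, hav, hvc⟩⟩
  obtain ⟨hw'P, hcw', hw'b⟩ := Finset.mem_filter.1 hw'
  obtain ⟨hv'P, hav', hv'c⟩ := Finset.mem_filter.1 hv'
  have hfw' : f w' ≤ a := (hw'min w (Finset.mem_filter.2 ⟨hwP, hcw, hwb⟩)).trans hwa
  have hfv' : b ≤ f v' := hbv.trans (hv'max v (Finset.mem_filter.2 ⟨hvP, hav, hvc⟩))
  -- A point between `f w'` and `a` that failed to cross `c` would be the `u` of a twist; similarly
  -- on the right. So the interval from `f w'` to `f v'` also qualifies, and by maximality it equals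
  -- `[a, b]`. That makes the cycle's part in `[a, b]` invariant, hence everything.
  have hsw' : ∀ x ∈ P, f w' ≤ x → x ≤ f v' → (x < c ↔ c < f x) := by
    intro x hx h1 h2
    by_cases hxa : x < a
    · have := (hex x v w').1 (by linarith) hvc hcw' h1 (by linarith)
      exact ⟨fun _ => this, fun _ => by linarith⟩
    · by_cases hxb : b < x
      · have := (hex x w v').2 hv'c hcw (by linarith) h2 (by linarith)
        constructor <;> intro <;> linarith
      · exact hsw x hx (by linarith) (by linarith)
  have hnew : (f w', f v') ∈ S :=
    Finset.mem_filter.2 ⟨Finset.mk_mem_product (hP.2 _ hw'P).1 (hP.2 _ hv'P).1,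
      by simp only; linarith, by simp only; linarith, hsw',
      ⟨v', hv'P, by simp only; linarith, hv'c, le_rfl⟩,
      ⟨w', hw'P, hcw', by simp only; linarith, le_rfl⟩⟩
  have hle := hmax _ hnew
  simp only at hle
  have hinv : ∀ x ∈ P, x ∈ Icc a b → f x ∈ Icc a b := by
    intro x hx ⟨h1, h2⟩
    have h3 := hsw x hx h1 h2
    rcases lt_or_gt_of_ne (hPc x hx) with h | h
    · have h4 := hv'max x (Finset.mem_filter.2 ⟨hx, h1, h⟩)
      have h5 := h3.1 h
      exact ⟨by linarith, by linarith⟩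
    · have h4 := hw'min x (Finset.mem_filter.2 ⟨hx, h, h2⟩)
      have h5 : ¬ c < f x := fun h' => by linarith [h3.2 h']
      exact ⟨by linarith, by linarith⟩
  have hall := hP.eq_of_mapsTo haP (s := Icc a b) ⟨le_rfl, by linarith⟩ hinv
  exact fun x hx => hsw x hx (hall x hx).1 (hall x hx).2

lemma two_mem_periods {f : ℝ → ℝ} (hf : Continuous f) {m : ℕ} (hm : m ∈ periods f)
    (h2 : 2 ≤ m) : 2 ∈ periods f := by
  classical
  obtain ⟨P, hP, hcard⟩ := exists_isCycle hm
  obtain ⟨a, ha, b, hb, c, hac, hcb, hc, hfa, hfb, hgap⟩ := hP.exists_center hf (by omega)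
  rcases hP.switch_or_even hf ha hb hac hcb hc hfa hfb hgap with hsw | hev
  swap
  · exact hev 1 one_pos
  have hmin := P.min'_mem hP.1
  have hmax := P.max'_mem hP.1
  have hle : ∀ x ∈ P, P.min' hP.1 ≤ x := fun x hx => P.min'_le x hx
  have hge : ∀ x ∈ P, x ≤ P.max' hP.1 := fun x hx => P.le_max' x hx
  have hpre : ∀ y ∈ P, ∃ x ∈ P, f x = y := by
    intro y hy
    have h1 := (hP.2 y hy).2.1
    refine ⟨f^[P.card - 1] y, ?_, ?_⟩
    · have : ∀ k, f^[k] y ∈ P := by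
        intro k
        induction k with
        | zero => exact hy
        | succ k ih => rw [iterate_succ_apply']; exact (hP.2 _ ih).1
      exact this _
    · rw [← iterate_succ_apply' f, show (P.card - 1).succ = P.card by omega, ← h1]
      exact iterate_minimalPeriod
  have hleft : ∀ x ∈ P, f x ≤ a → b ≤ x ∧ x ≤ P.max' hP.1 := fun x hx h => by
    refine ⟨(hgap x hx).resolve_left fun h' => ?_, hge x hx⟩
    linarith [(hsw x hx).1 (by linarith)]
  have hright : ∀ x ∈ P, b ≤ f x → P.min' hP.1 ≤ x ∧ x ≤ a := fun x hx h => by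
    refine ⟨hle x hx, (hgap x hx).resolve_right fun h' => ?_⟩
    linarith [(hsw x hx).2 (by linarith)]
  obtain ⟨p, hp, hfp⟩ := hpre _ hmin
  obtain ⟨q, hq, hfq⟩ := hpre _ hmax
  obtain ⟨p', hp', hfp'⟩ := hpre _ ha
  obtain ⟨q', hq', hfq'⟩ := hpre _ hb
  -- When all points switch, the hulls of the left and right halves of the cycle cover each other,
  -- and they are disjoint, so the loop of length 2 has no fixed point.
  let K : ℕ → Set ℝ := fun i => if Odd i then uIcc b (P.max' hP.1) else uIcc (P.min' hP.1) a
  have hmina := hle a ha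
  have hmaxb := hge b hb
  obtain ⟨x, hx, hxK⟩ := exists_follows_loop hf K (fun i => by
      simp only [K]; split_ifs <;> exact ordConnected_uIcc) 2 (fun i _ => by
      by_cases hi : Odd i
      · simp only [K, hi, if_true, if_neg (show ¬ Odd (i + 1) by grind)]
        rw [← hfp]
        nth_rw 1 [← hfp']
        exact (subset_image_uIcc hf subset_rfl).trans (image_mono (uIcc_subset_uIcc
          (mem_uIcc.2 (Or.inl (hleft p hp (by linarith))))
          (mem_uIcc.2 (Or.inl (hleft p' hp' (by linarith))))))
      · simp only [K, hi, if_false, if_pos (show Odd (i + 1) by grind)]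
        rw [← hfq]
        nth_rw 1 [← hfq']
        exact (subset_image_uIcc hf subset_rfl).trans (image_mono (uIcc_subset_uIcc
          (mem_uIcc.2 (Or.inl (hright q' hq' (by linarith))))
          (mem_uIcc.2 (Or.inl (hright q hq (by linarith)))))))
    (α := P.min' hP.1) (β := a) (by simp [K]) (by simp [K])
  refine mem_periods_of_forall_lt two_pos hx fun d hd0 hd2 _ hd => ?_
  obtain rfl : d = 1 := by omega
  have hfx : f x = x := minimalPeriod_eq_one_iff_isFixedPt.1 hd
  have h0 := hxK 0 (by omega)
  have h1 := hxK 1 (by omega)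
  simp only [K, iterate_zero, id, iterate_one, hfx] at h0 h1
  rw [if_neg (by decide), mem_uIcc] at h0
  rw [if_pos (by decide), mem_uIcc] at h1
  grind

/-! ### Odd periods -/

/-- Otherwise `f` would inject each side of `c` into the other, so both sides would have equally
many points. -/
lemma IsCycle.exists_not_switch {f : ℝ → ℝ} {P : Finset ℝ} (hP : IsCycle f P)
    (hodd : Odd P.card) {c : ℝ} (hc : c ∉ P) : ¬ ∀ x ∈ P, x < c ↔ c < f x := by
  classical
  intro hsw
  have hinj : Set.InjOn f P := by
    intro x hx y hy hxy
    have h1 := hP.2 x hx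
    have h2 := hP.2 y hy
    have hpos : 0 < P.card := Finset.card_pos.2 hP.1
    have e1 : f^[P.card] x = x := h1.2.1 ▸ iterate_minimalPeriod
    have e2 : f^[P.card] y = y := h2.2.1 ▸ iterate_minimalPeriod
    rw [← e1, ← e2, ← Nat.succ_pred_eq_of_pos hpos, iterate_succ_apply, iterate_succ_apply, hxy]
  have hne : ∀ x ∈ P, x ≠ c := fun x hx h => hc (h ▸ hx)
  have h1 : (P.filter (· < c)).card ≤ (P.filter (fun x => ¬ x < c)).card := by
    refine Finset.card_le_card_of_injOn f (fun x hx => ?_)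
      (hinj.mono fun x hx => (Finset.mem_filter.1 hx).1)
    obtain ⟨hx, hxc⟩ := Finset.mem_filter.1 hx
    exact Finset.mem_filter.2 ⟨(hP.2 x hx).1, not_lt.2 ((hsw x hx).1 hxc).le⟩
  have h2 : (P.filter (fun x => ¬ x < c)).card ≤ (P.filter (· < c)).card := by
    refine Finset.card_le_card_of_injOn f (fun x hx => ?_)
      (hinj.mono fun x hx => (Finset.mem_filter.1 hx).1)
    obtain ⟨hx, hxc⟩ := Finset.mem_filter.1 hx
    have h3 : ¬ c < f x := fun h => hxc ((hsw x hx).2 h)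
    have h4 := (hP.2 x hx).1
    exact Finset.mem_filter.2 ⟨h4, lt_of_le_of_ne (not_lt.1 h3) (hne _ h4)⟩
  have h3 := Finset.card_filter_add_card_filter_not (s := P) (· < c)
  rw [← h3] at hodd
  grind

/-- Write `I` for the hull of `a`, `b` and `J` for that of `u`, `a`. Since `I` covers itself, its
images `V i` increase, and `V (m - 1)` contains the whole orbit of `a`, hence `J`. As `J` covers
`I`, there is a loop `J I ⋯ I (V 1) ⋯ (V (m - 2)) J` with `t = l - (m - 1)` copies of `I`. -/
lemma odd_mem_periods_of_cover {f : ℝ → ℝ} (hf : Continuous f) {a b u : ℝ} {m l : ℕ}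
    (hm : Odd m) (hm3 : 3 ≤ m) (hl : Odd l) (hml : m < l)
    (hleast : ∀ d, Odd d → 1 < d → d < m → d ∉ periods f) (ha : minimalPeriod f a = m)
    (hab : uIcc a b ⊆ uIcc (f a) (f b)) (hu : uIcc a b ⊆ uIcc (f u) (f a))
    (hint : ∀ x ∈ uIcc u a, x ∈ uIcc a b → x = a)
    (horb : ∀ k, f^[k] a ∈ uIcc a b → f^[k] a = a ∨ f^[k] a = b)
    (huorb : ∃ j < m, f^[j] a = u) : l ∈ periods f := by
  classical
  let V : ℕ → Set ℝ := fun i => f^[i] '' uIcc a b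
  have hVmono : Monotone V := by
    refine monotone_nat_of_le_succ fun i => ?_
    simp only [V]
    rw [iterate_succ, image_comp]
    exact image_mono (subset_image_uIcc hf hab)
  have hVconn : ∀ i, (V i).OrdConnected := fun i =>
    (isPreconnected_uIcc.image _ (hf.iterate i).continuousOn).ordConnected
  have haV : a ∈ V (m - 1) := hVmono (Nat.zero_le _) ⟨a, left_mem_uIcc, rfl⟩
  have huV : u ∈ V (m - 1) := by
    obtain ⟨j, hj, rfl⟩ := huorb
    exact hVmono (show j ≤ m - 1 by omega) ⟨a, left_mem_uIcc, rfl⟩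
  obtain ⟨t, rfl⟩ : ∃ t, l = t + (m - 1) := ⟨l - (m - 1), by omega⟩
  -- Both `l` and `m` are odd, so `l ≥ m + 2`.
  have ht : 3 ≤ t := by grind
  let K : ℕ → Set ℝ := fun i =>
    if i = 0 ∨ i = t + (m - 1) then uIcc u a else if i ≤ t then uIcc a b else V (i - t)
  have hK : ∀ i, (K i).OrdConnected := by
    intro i
    simp only [K]
    split_ifs
    · exact ordConnected_uIcc
    · exact ordConnected_uIcc
    · exact hVconn _
  have hK1 : ∀ i, 1 ≤ i → i ≤ t → K i = uIcc a b := by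
    intro i h1 h2
    simp only [K]
    rw [if_neg (by omega), if_pos h2]
  have hKV : ∀ i, t ≤ i → i < t + (m - 1) → K i = V (i - t) := by
    intro i h1 h2
    rcases h1.eq_or_lt with rfl | h
    · rw [hK1 _ (by omega) le_rfl]
      simp [V]
    · simp only [K]
      rw [if_neg (by omega), if_neg (by omega)]
  have hcov : ∀ i < t + (m - 1), K (i + 1) ⊆ f '' K i := by
    intro i hi
    rcases Nat.eq_zero_or_pos i with rfl | h0
    · rw [hK1 _ (by omega) (by omega)]
      simp only [K, true_or, if_true]
      exact subset_image_uIcc hf hu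
    rcases Nat.lt_or_ge i t with h1 | h1
    · rw [hK1 _ (by omega) (by omega), hK1 _ (by omega) (by omega)]
      exact subset_image_uIcc hf hab
    have hstep : f '' K i = V (i + 1 - t) := by
      rw [hKV i h1 hi, show i + 1 - t = (i - t) + 1 by omega]
      simp only [V]
      rw [iterate_succ', image_comp]
    rw [hstep]
    rcases Nat.lt_or_ge (i + 1) (t + (m - 1)) with h2 | h2
    · rw [hKV _ (by omega) h2]
    · have h3 : i + 1 = t + (m - 1) := by omega
      simp only [K, h3, or_true, if_true]
      rw [show t + (m - 1) - t = m - 1 by omega]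
      exact (hVconn _).uIcc_subset huV haV
  obtain ⟨x, hx, hxK⟩ := exists_follows_loop hf K hK _ hcov (α := u) (β := a)
    (by simp [K]) (by simp [K])
  have hx0 : x ∈ uIcc u a := by simpa [K] using hxK 0 (by omega)
  refine mem_periods_of_forall_lt (by omega) hx fun d hd0 hdlt hdvd hd => ?_
  have hfd : f^[d] x = x := hd ▸ iterate_minimalPeriod
  obtain ⟨e, he⟩ := hdvd
  have hdodd : Odd d := by
    rw [he] at hl
    exact (Nat.odd_mul.1 hl).1
  have heodd : Odd e := by
    rw [he] at hl
    exact (Nat.odd_mul.1 hl).2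
  have he3 : 3 ≤ e := by
    rcases Nat.lt_or_ge e 3 with h | h
    · obtain rfl : e = 1 := by
        obtain ⟨r, rfl⟩ := heodd
        omega
      omega
    · exact h
  have h3d : 3 * d ≤ t + (m - 1) := by rw [he]; nlinarith
  -- If `t < d`, then `3 * d ≤ t + (m - 1)` makes `d` an odd period below `m`, against minimality.
  -- Otherwise `x` returns to `I` at time `d`, so `x = a`, whose first iterates would all lie in
  -- `I`, where the orbit has only `a` and `b`.
  rcases Nat.lt_or_ge t d with htd | htd
  · exact hleast d hdodd (by omega) (by omega) ⟨hd0, x, hd⟩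
  · have hxI := hxK d (by omega)
    rw [hfd, hK1 d hd0 htd] at hxI
    obtain rfl := hint x hx0 hxI
    have key : ∀ i, 1 ≤ i → i ≤ 3 → f^[i] x = b := by
      intro i hi1 hi3
      have h1 := hxK i (by omega)
      rw [hK1 i hi1 (by omega)] at h1
      refine (horb i h1).resolve_left fun h => ?_
      have h2 : m ∣ i := ha ▸ IsPeriodicPt.minimalPeriod_dvd h
      have h3 := Nat.le_of_dvd (by omega) h2
      obtain rfl : i = 3 := by omega
      obtain rfl : m = 3 := by omega
      have h4 := hxK 1 (by omega)
      have h5 := hxK 2 (by omega)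
      rw [hK1 _ (by omega) (by omega)] at h4 h5
      have hno : ∀ k, 1 ≤ k → k ≤ 2 → f^[k] x ≠ x := by
        intro k hk1 hk2 hk
        have h6 : 3 ∣ k := ha ▸ IsPeriodicPt.minimalPeriod_dvd hk
        have := Nat.le_of_dvd (by omega) h6
        omega
      have h6 := (horb 1 h4).resolve_left (hno 1 le_rfl (by omega))
      have h7 := (horb 2 h5).resolve_left (hno 2 (by omega) le_rfl)
      have h8 := (iterate_eq_iterate_iff_of_lt_minimalPeriod (f := f) (x := x) (m := 1) (n := 2)
        (by omega) (by omega)).1 (h6.trans h7.symm)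
      omega
    have h8 := (iterate_eq_iterate_iff_of_lt_minimalPeriod (f := f) (x := x) (m := 1) (n := 2)
      (by omega) (by omega)).1 ((key 1 le_rfl (by omega)).trans (key 2 (by omega) (by omega)).symm)
    omega

lemma mem_periods_of_odd {f : ℝ → ℝ} (hf : Continuous f) {m l : ℕ} (hm : m ∈ periods f)
    (hodd : Odd m) (hm1 : 1 < m) (hl : (Odd l ∧ m < l) ∨ (Even l ∧ 0 < l)) :
    l ∈ periods f := by
  classical
  -- The loop argument needs the least odd period greater than 1, so `m` is replaced by it.
  have hex : ∃ d, Odd d ∧ 1 < d ∧ d ∈ periods f := ⟨m, hodd, hm1, hm⟩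
  obtain ⟨hdodd, hd1, hd⟩ := Nat.find_spec hex
  have hdm : Nat.find hex ≤ m := Nat.find_min' hex ⟨hodd, hm1, hm⟩
  have hleast : ∀ e, Odd e → 1 < e → e < Nat.find hex → e ∉ periods f :=
    fun e h1 h2 h3 h4 => Nat.find_min hex h3 ⟨h1, h2, h4⟩
  generalize Nat.find hex = d at *
  obtain ⟨P, hP, hcard⟩ := exists_isCycle hd
  obtain ⟨a, ha, b, hb, c, hac, hcb, hc, hfa, hfb, hgap⟩ := hP.exists_center hf (by omega)
  have hcP : c ∉ P := fun h => by rcases hgap c h with h' | h' <;> linarith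
  have hns := hP.exists_not_switch (hcard ▸ hdodd) hcP
  rcases hl with ⟨hlo, hml⟩ | ⟨hle, hl0⟩
  swap
  · obtain ⟨j, rfl⟩ := hle
    rw [← two_mul]
    exact ((hP.switch_or_even hf ha hb hac hcb hc hfa hfb hgap).resolve_left hns) j (by omega)
  push Not at hns
  obtain ⟨u, huP, hu⟩ := hns
  have hPk : ∀ x ∈ P, ∀ k, f^[k] x ∈ P := by
    intro x hx k
    induction k with
    | zero => exact hx
    | succ k ih => rw [iterate_succ_apply']; exact (hP.2 _ ih).1
  have hfu := (hP.2 u huP).1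
  have hd3 : 3 ≤ d := by grind
  rcases hu with ⟨huc, hfuc⟩ | ⟨huc, hfuc⟩
  · have hua : u ≤ a := (hgap u huP).resolve_right (by linarith)
    have hfua : f u ≤ a := (hgap _ hfu).resolve_right fun h => by linarith
    refine odd_mem_periods_of_cover hf (a := a) (b := b) (u := u) hdodd hd3 hlo (by omega) hleast
      (by rw [(hP.2 a ha).2.1, hcard]) ?_ ?_ ?_ ?_ (hcard ▸ (hP.2 a ha).2.2 u huP)
    · intro x hx; rw [mem_uIcc] at *; grind
    · intro x hx; rw [mem_uIcc] at *; grind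
    · intro x hx; rw [mem_uIcc] at *; grind
    · intro k hk; have := hgap _ (hPk a ha k); rw [mem_uIcc] at *; grind
  · have hub : b ≤ u := (hgap u huP).resolve_left (by linarith)
    have hfub : b ≤ f u := (hgap _ hfu).resolve_left fun h => by linarith
    refine odd_mem_periods_of_cover hf (a := b) (b := a) (u := u) hdodd hd3 hlo (by omega) hleast
      (by rw [(hP.2 b hb).2.1, hcard]) ?_ ?_ ?_ ?_ (hcard ▸ (hP.2 b hb).2.2 u huP)
    · intro x hx; rw [mem_uIcc] at *; grind
    · intro x hx; rw [mem_uIcc] at *; grind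
    · intro x hx; rw [mem_uIcc] at *; grind
    · intro k hk; have := hgap _ (hPk b hb k); rw [mem_uIcc] at *; grind

end Sharkovsky

/-! ### The ordering and the forcing theorem. -/

namespace Sharkovsky

open Set Function

/-! ### The ordering -/

lemma two_pow_mul_odd_inj {a b p q : ℕ} (hp : Odd p) (hq : Odd q)
    (h : 2 ^ a * p = 2 ^ b * q) : a = b ∧ p = q := by
  have key : ∀ {a b p q : ℕ}, Odd p → 2 ^ a * p = 2 ^ b * q → b ≤ a := by
    intro a b p q hp h
    have h1 : 2 ^ b ∣ 2 ^ a * p := ⟨q, h⟩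
    have h2 : Nat.Coprime (2 ^ b) p := (Nat.coprime_two_left.2 hp).pow_left b
    exact (Nat.pow_dvd_pow_iff_le_right (by norm_num)).1 (h2.dvd_of_dvd_mul_right h1)
  obtain rfl : a = b := le_antisymm (key hq h.symm) (key hp h)
  exact ⟨rfl, Nat.eq_of_mul_eq_mul_left (by positivity) h⟩

lemma prec_iff {a b p q : ℕ} (hp : Odd p) (hq : Odd q) :
    Prec (2 ^ a * p) (2 ^ b * q) ↔
      (1 < p ∧ 1 < q ∧ (a < b ∨ (a = b ∧ p < q))) ∨ (1 < p ∧ q = 1) ∨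
        (p = 1 ∧ q = 1 ∧ b < a) := by
  constructor
  · rintro ⟨a', p', b', q', hp', hq', h1, h2, h⟩
    obtain ⟨rfl, rfl⟩ := two_pow_mul_odd_inj hp hp' h1
    obtain ⟨rfl, rfl⟩ := two_pow_mul_odd_inj hq hq' h2
    exact h
  · exact fun h => ⟨a, p, b, q, hp, hq, rfl, rfl, h⟩

lemma prec_or_eq_or_prec {m n : ℕ} (hm : 0 < m) (hn : 0 < n) :
    Prec m n ∨ m = n ∨ Prec n m := by
  obtain ⟨a, p, hp, rfl⟩ := Nat.exists_eq_two_pow_mul_odd hm.ne'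
  obtain ⟨b, q, hq, rfl⟩ := Nat.exists_eq_two_pow_mul_odd hn.ne'
  have hp1 := hp.pos
  have hq1 := hq.pos
  rw [prec_iff hp hq, prec_iff hq hp]
  by_cases h : a = b ∧ p = q
  · rw [h.1, h.2]; simp
  · omega

lemma Prec.ne {m n : ℕ} (h : Prec m n) : m ≠ n := by
  rintro rfl
  obtain ⟨a, p, b, q, hp, hq, rfl, h2, h⟩ := h
  obtain ⟨rfl, rfl⟩ := two_pow_mul_odd_inj hp hq h2
  omega

lemma precEq_three {n : ℕ} (hn : 0 < n) : PrecEq 3 n := by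
  obtain ⟨b, q, hq, rfl⟩ := Nat.exists_eq_two_pow_mul_odd hn.ne'
  have h := prec_iff (a := 0) (b := b) (p := 3) (by decide) hq
  simp only [pow_zero, one_mul] at h
  rw [PrecEq, h]
  by_cases h0 : b = 0 ∧ q = 3
  · rw [h0.1, h0.2]; simp
  · obtain ⟨r, rfl⟩ := hq
    omega

lemma prec_two_pow {a p b : ℕ} (hp : Odd p) (hp1 : 1 < p) : Prec (2 ^ a * p) (2 ^ b) := by
  have := prec_iff (a := a) (b := b) hp odd_one
  rw [mul_one] at this
  rw [this]
  omega

/-- Tails are the principal ones and the set of all powers of two. -/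
lemma IsTail.cases {S : Set ℕ} (hS : IsTail S) :
    (∃ k, 0 < k ∧ S = {n | PrecEq k n}) ∨ S = {n | ∃ i : ℕ, n = 2 ^ i} := by
  classical
  obtain ⟨hne, hpos, hcl⟩ := hS
  by_cases hmin : ∃ k ∈ S, ∀ n ∈ S, ¬ Prec n k
  · obtain ⟨k, hk, hkmin⟩ := hmin
    refine Or.inl ⟨k, hpos k hk, Set.ext fun n => ⟨fun hn => ?_, ?_⟩⟩
    · rcases prec_or_eq_or_prec (hpos k hk) (hpos n hn) with h | h | h
      · exact Or.inr h
      · exact Or.inl h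
      · exact (hkmin n hn h).elim
    · rintro (rfl | h)
      · exact hk
      · exact hcl k hk n h
  · right
    push Not at hmin
    have hpow : ∀ n ∈ S, ∃ i : ℕ, n = 2 ^ i := by
      by_contra hcon
      push Not at hcon
      obtain ⟨n, hn, hnp⟩ := hcon
      -- A non-power of two in `S` yields a first element: take the least exponent `a`, then the
      -- least odd part greater than 1 at that exponent.
      have hex : ∃ a, ∃ p, Odd p ∧ 1 < p ∧ 2 ^ a * p ∈ S := by
        obtain ⟨a, p, hp, rfl⟩ := Nat.exists_eq_two_pow_mul_odd (hpos n hn).ne'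
        refine ⟨a, p, hp, ?_, hn⟩
        have hp0 := hp.pos
        have hp1 : p ≠ 1 := fun h => hnp a (by rw [h, mul_one])
        omega
      have hex2 := Nat.find_spec hex
      obtain ⟨hp, hp1, hpS⟩ := Nat.find_spec hex2
      obtain ⟨m, hm, hmk⟩ := hmin _ hpS
      obtain ⟨b, q, hq, rfl⟩ := Nat.exists_eq_two_pow_mul_odd (hpos m hm).ne'
      rw [prec_iff hq hp] at hmk
      have hq1 : 1 < q := by omega
      have h1 : Nat.find hex ≤ b := Nat.find_min' hex ⟨q, hq, hq1, hm⟩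
      rcases h1.eq_or_lt with h2 | h2
      · have h3 : Nat.find hex2 ≤ q := Nat.find_min' hex2 ⟨hq, hq1, h2 ▸ hm⟩
        omega
      · omega
    refine Set.ext fun n => ⟨hpow n, ?_⟩
    rintro ⟨j, rfl⟩
    have hbig : ∀ j : ℕ, ∃ i, j ≤ i ∧ 2 ^ i ∈ S := by
      intro j
      induction j with
      | zero =>
        obtain ⟨n, hn⟩ := hne
        obtain ⟨i, rfl⟩ := hpow n hn
        exact ⟨i, Nat.zero_le _, hn⟩
      | succ j ih =>
        obtain ⟨i, hji, hi⟩ := ih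
        obtain ⟨m, hm, hmi⟩ := hmin _ hi
        obtain ⟨l, rfl⟩ := hpow m hm
        have := prec_iff (a := l) (b := i) odd_one odd_one
        rw [mul_one, mul_one] at this
        rw [this] at hmi
        exact ⟨l, by omega, hm⟩
    obtain ⟨i, hji, hi⟩ := hbig j
    rcases hji.eq_or_lt with rfl | h
    · exact hi
    · refine hcl _ hi _ ?_
      have := prec_iff (a := i) (b := j) odd_one odd_one
      rw [mul_one, mul_one] at this
      rw [this]
      omega

/-! ### Forcing -/

lemma mem_periods_iterate {f : ℝ → ℝ} {a p : ℕ} (h : 2 ^ a * p ∈ periods f) :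
    p ∈ periods f^[2 ^ a] := by
  obtain ⟨hpos, x, hx⟩ := h
  refine ⟨Nat.pos_of_mul_pos_left hpos, x, ?_⟩
  rw [minimalPeriod_iterate_eq_div_gcd (by positivity), hx, Nat.gcd_mul_right_left,
    Nat.mul_div_cancel_left _ (by positivity)]

/-- If `N` is the period under `f`, then `e = N / gcd(N, 2 ^ a)`. With the gcd equal to `2 ^ j` and
`j < a`, an even `e` would make the gcd larger. -/
lemma exists_mem_periods_of_iterate {f : ℝ → ℝ} {a e : ℕ} (h : e ∈ periods f^[2 ^ a]) :
    ∃ j ≤ a, 2 ^ j * e ∈ periods f ∧ (j < a → Odd e) := by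
  obtain ⟨hpos, x, hx⟩ := h
  have hper : x ∈ periodicPts f := by
    have h1 : (f^[2 ^ a])^[e] x = x := hx ▸ iterate_minimalPeriod
    rw [← iterate_mul] at h1
    exact mk_mem_periodicPts (n := 2 ^ a * e) (by positivity) h1
  have hN := minimalPeriod_pos_of_mem_periodicPts hper
  rw [minimalPeriod_iterate_eq_div_gcd (by positivity)] at hx
  obtain ⟨j, hj, hgcd⟩ := (Nat.dvd_prime_pow Nat.prime_two).1
    (Nat.gcd_dvd_right (minimalPeriod f x) (2 ^ a))
  have hdvd : 2 ^ j ∣ minimalPeriod f x := hgcd ▸ Nat.gcd_dvd_left _ _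
  rw [hgcd] at hx
  have hNe : minimalPeriod f x = 2 ^ j * e := by rw [← hx, Nat.mul_div_cancel' hdvd]
  refine ⟨j, hj, ⟨hNe ▸ hN, x, hNe⟩, fun hja => ?_⟩
  by_contra hodd
  obtain ⟨r, hr⟩ := (Nat.not_odd_iff_even.1 hodd).two_dvd
  have h1 : 2 ^ (j + 1) ∣ minimalPeriod f x := ⟨r, by rw [hNe, hr]; ring⟩
  have h2 := Nat.dvd_gcd h1 (pow_dvd_pow 2 (show j + 1 ≤ a by omega))
  rw [hgcd, Nat.pow_dvd_pow_iff_le_right (by norm_num)] at h2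
  omega

lemma even_mem_periods_of_iterate {f : ℝ → ℝ} {a e : ℕ} (h : e ∈ periods f^[2 ^ a])
    (he : Even e) : 2 ^ a * e ∈ periods f := by
  obtain ⟨j, hj, hmem, hodd⟩ := exists_mem_periods_of_iterate h
  rcases hj.eq_or_lt with rfl | hlt
  · exact hmem
  · exact (Nat.not_odd_iff_even.2 he (hodd hlt)).elim

lemma even_mem_periods_of_two_pow_mul_odd {f : ℝ → ℝ} (hf : Continuous f) {a p e : ℕ}
    (hm : 2 ^ a * p ∈ periods f) (hp : Odd p) (hp1 : 1 < p) (he : Even e) (he0 : 0 < e) :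
    2 ^ a * e ∈ periods f :=
  even_mem_periods_of_iterate
    (mem_periods_of_odd (hf.iterate _) (mem_periods_iterate hm) hp hp1 (Or.inr ⟨he, he0⟩)) he

lemma two_pow_mem_periods {f : ℝ → ℝ} (hf : Continuous f) {a b : ℕ}
    (hm : 2 ^ a ∈ periods f) (hba : b < a) : 2 ^ b ∈ periods f := by
  cases b with
  | zero => exact one_mem_periods hf hm
  | succ b =>
    have h1 : 2 ^ a = 2 ^ b * 2 ^ (a - b) := by rw [← pow_add]; congr 1; omega
    -- Under `f^[2 ^ b]` the point has period `2 ^ (a - b) ≥ 2`, which forces period 2; being even,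
    -- it pulls back exactly to `2 ^ b * 2`.
    rw [h1] at hm
    rw [pow_succ]
    exact even_mem_periods_of_iterate (two_mem_periods (hf.iterate _) (mem_periods_iterate hm)
      (Nat.le_self_pow (by omega) 2)) even_two

/-- **Sharkovsky's theorem** for continuous self-maps of the line. -/
theorem mem_periods_of_prec {f : ℝ → ℝ} (hf : Continuous f) {m n : ℕ} (hm : m ∈ periods f)
    (h : Prec m n) : n ∈ periods f := by
  obtain ⟨a, p, b, q, hp, hq, rfl, rfl, h⟩ := h
  have hq0 := hq.pos
  have hgt : 1 < p → a < b → 2 ^ b * q ∈ periods f := by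
    intro hp1 hab
    obtain ⟨c, rfl⟩ := Nat.exists_eq_add_of_lt hab
    rw [show 2 ^ (a + c + 1) * q = 2 ^ a * (2 * (2 ^ c * q)) by ring]
    exact even_mem_periods_of_two_pow_mul_odd hf hm hp hp1 (even_two_mul _) (by positivity)
  rcases h with ⟨hp1, hq1, hab | ⟨rfl, hpq⟩⟩ | ⟨hp1, rfl⟩ | ⟨rfl, rfl, hba⟩
  · exact hgt hp1 hab
  · have h1 := mem_periods_of_odd (hf.iterate _) (mem_periods_iterate hm) hp hp1
      (Or.inl ⟨hq, hpq⟩)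
    -- Pulling back an odd period may lose factors of two. If `j < a`, they are recovered by letting
    -- `2 ^ j * q` force its even multiples.
    obtain ⟨j, hj, hmem, -⟩ := exists_mem_periods_of_iterate h1
    rcases hj.eq_or_lt with rfl | hlt
    · exact hmem
    · obtain ⟨c, rfl⟩ := Nat.exists_eq_add_of_lt hlt
      rw [show 2 ^ (j + c + 1) * q = 2 ^ j * (2 * (2 ^ c * q)) by ring]
      exact even_mem_periods_of_two_pow_mul_odd hf hmem hq hq1 (even_two_mul _) (by positivity)
  · rcases Nat.lt_or_ge a b with hab | hab
    · exact hgt hp1 hab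
    · have h1 : 2 ^ (a + 1) ∈ periods f := by
        rw [pow_succ]
        exact even_mem_periods_of_two_pow_mul_odd hf hm hp hp1 even_two two_pos
      rw [mul_one]
      exact two_pow_mem_periods hf h1 (by omega)
  · rw [mul_one] at hm ⊢
    exact two_pow_mem_periods hf hm hba

/-! ### Self-maps of intervals -/

lemma minimalPeriod_eq_of_semiconj {α β : Type*} {f : α → α} {g : β → β} {φ : α → β}
    (hφ : Injective φ) (h : Semiconj φ f g) (x : α) :
    minimalPeriod g (φ x) = minimalPeriod f x := by
  refine minimalPeriod_eq_minimalPeriod_iff.2 fun n => ?_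
  have h1 : φ (f^[n] x) = g^[n] (φ x) := h.iterate_right n x
  rw [IsPeriodicPt, IsFixedPt, ← h1, hφ.eq_iff]
  rfl

/-- Periodic points of `g` lie in its range, so none is missed by `φ`. -/
lemma periods_eq_of_semiconj {α β : Type*} {f : α → α} {g : β → β} {φ : α → β}
    (hφ : Injective φ) (h : Semiconj φ f g) (hg : range g ⊆ range φ) :
    periods g = periods f := by
  ext n
  constructor
  · rintro ⟨hn, y, hy⟩
    have hper : y ∈ periodicPts g := minimalPeriod_pos_iff_mem_periodicPts.1 (by omega)
    obtain ⟨x, rfl⟩ := hg (periodicPts_subset_range hper)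
    exact ⟨hn, x, by rw [← hy, minimalPeriod_eq_of_semiconj hφ h]⟩
  · rintro ⟨hn, x, hx⟩
    exact ⟨hn, φ x, by rw [← hx, minimalPeriod_eq_of_semiconj hφ h]⟩

/-- **Sharkovsky's theorem** for continuous self-maps of a compact interval. -/
theorem mem_periods_Icc_of_prec {a b : ℝ} (hab : a ≤ b) {f : Icc a b → Icc a b}
    (hf : Continuous f) {m n : ℕ} (hm : m ∈ periods f) (h : Prec m n) : n ∈ periods f := by
  let F : ℝ → ℝ := fun x => f (projIcc a b hab x)
  have hF : Continuous F := continuous_subtype_val.comp (hf.comp continuous_projIcc)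
  have heq : periods F = periods f := by
    refine periods_eq_of_semiconj (φ := ((↑) : Icc a b → ℝ)) Subtype.val_injective ?_ ?_
    · intro x
      simp [F]
    · rintro _ ⟨x, rfl⟩
      exact ⟨_, rfl⟩
  rw [← heq] at hm ⊢
  exact mem_periods_of_prec hF hm h

lemma exists_conj_Icc {a b : ℝ} (hab : a < b) {f : Icc (0 : ℝ) 1 → Icc (0 : ℝ) 1}
    (hf : Continuous f) :
    ∃ g : Icc a b → Icc a b, Continuous g ∧ periods g = periods f := by
  let e := iccHomeoI a b hab
  refine ⟨e.symm ∘ f ∘ e, by fun_prop, ?_⟩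
  refine periods_eq_of_semiconj (φ := e.symm) e.symm.injective (fun x => by simp) ?_
  rw [e.symm.surjective.range_eq]
  exact subset_univ _

end Sharkovsky

/-! ### Realizing tails by truncated tent maps. -/

namespace Sharkovsky

open Set Function

/-! ### Periodic orbits -/

section Orbits

variable {α : Type*} {f g : α → α} {n : ℕ} {P R : Set α}

lemma IsPeriodicOrbit.nonempty (h : IsPeriodicOrbit f n P) : P.Nonempty := by
  obtain ⟨-, y, -, rfl⟩ := h
  exact range_nonempty _

lemma IsPeriodicOrbit.mem_periods (h : IsPeriodicOrbit f n P) : n ∈ periods f :=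
  ⟨h.1, h.2.choose, h.2.choose_spec.1⟩

lemma exists_isPeriodicOrbit (h : n ∈ periods f) : ∃ P, IsPeriodicOrbit f n P :=
  ⟨_, h.1, h.2.choose, h.2.choose_spec, rfl⟩

lemma IsPeriodicOrbit.iterate_mem (h : IsPeriodicOrbit f n P) {x : α} (hx : x ∈ P) (k : ℕ) :
    f^[k] x ∈ P := by
  obtain ⟨-, y, -, rfl⟩ := h
  obtain ⟨l, rfl⟩ := hx
  exact ⟨k + l, iterate_add_apply f k l y⟩

lemma IsPeriodicOrbit.eq_of_mem (h : IsPeriodicOrbit f n P) {x : α} (hx : x ∈ P) :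
    minimalPeriod f x = n ∧ P = range (fun k : ℕ => f^[k] x) := by
  have h0 := h
  obtain ⟨hn, y, hy, rfl⟩ := h
  obtain ⟨l, rfl⟩ := hx
  have hper : y ∈ periodicPts f := minimalPeriod_pos_iff_mem_periodicPts.1 (by omega)
  refine ⟨by rw [← hy]; exact minimalPeriod_apply_iterate hper l, Subset.antisymm ?_ ?_⟩
  · rintro _ ⟨k, rfl⟩
    -- Since `n * l` is a multiple of the period, `n * l - l` further steps take `f^[l] y` back to
    -- `y`.
    refine ⟨k + (n * l - l), ?_⟩
    simp only
    rw [← iterate_add_apply, add_assoc, Nat.sub_add_cancel (Nat.le_mul_of_pos_left l hn),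
      iterate_add_apply]
    congr 1
    exact (show IsPeriodicPt f n y from hy ▸ iterate_minimalPeriod).mul_const l
  · rintro _ ⟨k, rfl⟩
    exact h0.iterate_mem (mem_range_self l) k

lemma IsPeriodicOrbit.finite (h : IsPeriodicOrbit f n P) : P.Finite := by
  obtain ⟨hn, y, hy, rfl⟩ := h
  refine ((finite_Iio n).image fun k => f^[k] y).subset ?_
  rintro _ ⟨k, rfl⟩
  refine ⟨k % n, Nat.mod_lt _ hn, ?_⟩
  simp only
  rw [← hy]
  exact iterate_mod_minimalPeriod_eq

lemma IsPeriodicOrbit.period_eq {k : ℕ} (h : IsPeriodicOrbit f n P) (h' : IsPeriodicOrbit f k R)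
    {x : α} (hx : x ∈ P) (hx' : x ∈ R) : n = k := by
  rw [← (h.eq_of_mem hx).1, (h'.eq_of_mem hx').1]

lemma IsPeriodicOrbit.congr (h : IsPeriodicOrbit f n P) (hfg : ∀ x ∈ P, f x = g x) :
    IsPeriodicOrbit g n P := by
  have h0 := h
  obtain ⟨hn, y, hy, rfl⟩ := h
  have hit : ∀ k, g^[k] y = f^[k] y := by
    intro k
    induction k with
    | zero => rfl
    | succ k ih =>
      rw [iterate_succ_apply', iterate_succ_apply', ih, hfg _ (mem_range_self k)]
  refine ⟨hn, y, ?_, by simp only [hit]⟩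
  rw [← hy, minimalPeriod_eq_minimalPeriod_iff]
  intro k
  rw [IsPeriodicPt, IsFixedPt, hit]
  rfl

end Orbits

/-! ### Truncated tent maps -/

local notation "𝕀" => Set.Icc (0 : ℝ) 1

lemma continuous_tent : Continuous tent := by
  unfold tent
  fun_prop

lemma continuous_truncTent (lo hi : 𝕀) : Continuous (truncTent lo hi) := by
  unfold truncTent
  exact continuous_const.max (continuous_const.min continuous_tent)

lemma truncTent_mem_Icc {lo hi : 𝕀} (h : lo ≤ hi) (x : 𝕀) : truncTent lo hi x ∈ Icc lo hi :=
  ⟨le_max_left _ _, max_le h (min_le_left _ _)⟩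

lemma truncTent_eq {lo hi x : 𝕀} (h : tent x ∈ Icc lo hi) : tent x = truncTent lo hi x := by
  rw [truncTent, min_eq_right h.2, max_eq_right h.1]

lemma truncTent_eq_of_ne {lo hi x : 𝕀} (h1 : truncTent lo hi x ≠ lo)
    (h2 : truncTent lo hi x ≠ hi) : truncTent lo hi x = tent x := by
  unfold truncTent at *
  grind

lemma IsPeriodicOrbit.csInf_mem {f : 𝕀 → 𝕀} {n : ℕ} {P : Set 𝕀} (h : IsPeriodicOrbit f n P) :
    sInf P ∈ P := h.nonempty.csInf_mem h.finite

lemma IsPeriodicOrbit.csSup_mem {f : 𝕀 → 𝕀} {n : ℕ} {P : Set 𝕀} (h : IsPeriodicOrbit f n P) :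
    sSup P ∈ P := h.nonempty.csSup_mem h.finite

lemma subset_Icc_sInf_sSup (P : Set 𝕀) : P ⊆ Icc (sInf P) (sSup P) :=
  fun _ hx => ⟨sInf_le hx, le_sSup hx⟩

lemma IsPeriodicOrbit.sInf_le_sSup {f : 𝕀 → 𝕀} {n : ℕ} {P : Set 𝕀} (h : IsPeriodicOrbit f n P) :
    sInf P ≤ sSup P := le_sSup h.csInf_mem

lemma IsPeriodicOrbit.diam_lt {f : 𝕀 → 𝕀} {n : ℕ} {P : Set 𝕀} (h : IsPeriodicOrbit f n P)
    {lo hi : 𝕀} (hP : P ⊆ Ioo lo hi) : diam P < (hi : ℝ) - lo := by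
  have h1 : (lo : ℝ) < (sInf P : 𝕀) := (hP h.csInf_mem).1
  have h2 : ((sSup P : 𝕀) : ℝ) < hi := (hP h.csSup_mem).2
  unfold diam
  linarith

/-- An orbit of the tent map between the truncation heights is an orbit of the truncation. -/
lemma IsPeriodicOrbit.truncTent {n : ℕ} {P : Set 𝕀} (h : IsPeriodicOrbit tent n P) {lo hi : 𝕀}
    (hP : P ⊆ Icc lo hi) : IsPeriodicOrbit (truncTent lo hi) n P :=
  h.congr fun _ hx => truncTent_eq (hP (h.iterate_mem hx 1))

/-- An orbit of the truncation avoiding the truncation heights is an orbit of the tent map. -/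
lemma IsPeriodicOrbit.of_truncTent {lo hi : 𝕀} (hle : lo ≤ hi) {n : ℕ} {R : Set 𝕀}
    (h : IsPeriodicOrbit (Sharkovsky.truncTent lo hi) n R) (hlo : lo ∉ R) (hhi : hi ∉ R) :
    IsPeriodicOrbit tent n R ∧ R ⊆ Ioo lo hi := by
  refine ⟨h.congr fun x hx => ?_, fun x hx => ?_⟩
  · have h1 := h.iterate_mem hx 1
    exact truncTent_eq_of_ne (fun h' => hlo (h' ▸ h1)) (fun h' => hhi (h' ▸ h1))
  · have hx' := hx
    obtain ⟨hper, -⟩ := h.eq_of_mem hx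
    have hmem : x ∈ periodicPts (Sharkovsky.truncTent lo hi) :=
      minimalPeriod_pos_iff_mem_periodicPts.1 (by rw [hper]; exact h.1)
    obtain ⟨y, rfl⟩ := periodicPts_subset_range hmem
    have h1 := truncTent_mem_Icc hle y
    exact ⟨lt_of_le_of_ne h1.1 fun h' => hlo (h' ▸ hx'),
      lt_of_le_of_ne h1.2 fun h' => hhi (h' ▸ hx')⟩

/-- Forcing within the range of a periodic orbit of the tent map. -/
lemma IsPeriodicOrbit.exists_subset_Ioo {n k : ℕ} {P : Set 𝕀} (h : IsPeriodicOrbit tent n P)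
    (hnk : Prec n k) : ∃ R, IsPeriodicOrbit tent k R ∧ R ⊆ Ioo (sInf P) (sSup P) := by
  -- Truncate at the ends of `P`. A forced orbit has another period, so it is disjoint from `P` and
  -- in particular misses both heights.
  have hP := h.truncTent (subset_Icc_sInf_sSup P)
  obtain ⟨R, hR⟩ := exists_isPeriodicOrbit (mem_periods_Icc_of_prec zero_le_one
    (continuous_truncTent _ _) hP.mem_periods hnk)
  exact ⟨R, hR.of_truncTent h.sInf_le_sSup
    (fun hx => hnk.ne (hP.period_eq hR h.csInf_mem hx))
    (fun hx => hnk.ne (hP.period_eq hR h.csSup_mem hx))⟩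

/-! ### Periodic orbits of the tent map -/

/-- At each point the `k`-th iterate agrees with an affine map of slope `±2 ^ k` and integer
constant term. Fixed points thus have the form `m / (1 - s * 2 ^ k)` with `m` bounded, which makes
them finite in number and lets a smallest diameter be attained. -/
lemma tent_iterate_eq (k : ℕ) (x : 𝕀) :
    ∃ s ∈ ({1, -1} : Set ℝ), ∃ m : ℤ, (tent^[k] x : ℝ) = s * 2 ^ k * x + m := by
  induction k with
  | zero => exact ⟨1, by simp, 0, by simp⟩
  | succ k ih =>
    obtain ⟨s, hs, m, hm⟩ := ih
    rw [iterate_succ_apply']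
    have h1 : (tent (tent^[k] x) : ℝ) = 1 - |2 * (tent^[k] x : ℝ) - 1| := rfl
    rw [h1, hm]
    rcases abs_choice (2 * (s * 2 ^ k * (x : ℝ) + m) - 1) with h | h
    · refine ⟨-s, ?_, 2 - 2 * m, ?_⟩
      · rcases hs with rfl | rfl <;> simp
      · rw [h]; push_cast; ring
    · refine ⟨s, hs, 2 * m, ?_⟩
      rw [h]; push_cast; ring

lemma finite_tent_periodic {k : ℕ} (hk : 0 < k) : {x : 𝕀 | tent^[k] x = x}.Finite := by
  have hfin : (({1, -1} : Set ℝ) ×ˢ Icc (-(2 ^ k + 1) : ℤ) (2 ^ k + 1)).Finite :=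
    (toFinite _).prod (finite_Icc _ _)
  refine Finite.subset (((hfin.image fun z => (z.2 : ℝ) / (1 - z.1 * 2 ^ k)).preimage
    Subtype.val_injective.injOn : (((↑) : 𝕀 → ℝ) ⁻¹' _).Finite)) fun x hx => ?_
  obtain ⟨s, hs, m, hm⟩ := tent_iterate_eq k x
  rw [show tent^[k] x = x from hx] at hm
  have h2 : (2 : ℝ) ≤ 2 ^ k := by
    calc (2 : ℝ) = 2 ^ 1 := (pow_one _).symm
      _ ≤ 2 ^ k := pow_le_pow_right₀ one_le_two hk
  have hx0 := x.2.1
  have hx1 := x.2.2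
  have hne : 1 - s * 2 ^ k ≠ 0 := by
    rcases hs with rfl | rfl
    · exact ne_of_lt (by linarith)
    · exact ne_of_gt (by linarith)
  have hxm : (m : ℝ) = x * (1 - s * 2 ^ k) := by linarith
  have hbd : -(2 ^ k + 1 : ℝ) ≤ m ∧ (m : ℝ) ≤ 2 ^ k + 1 := by
    rw [hxm]
    rcases hs with rfl | rfl <;> constructor <;> nlinarith
  refine ⟨(s, m), ⟨hs, ?_, ?_⟩, ?_⟩
  · exact_mod_cast hbd.1
  · exact_mod_cast hbd.2
  · simp only
    rw [hxm, mul_div_cancel_right₀ _ hne]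

lemma finite_tent_orbits {k : ℕ} (hk : 0 < k) : {P | IsPeriodicOrbit tent k P}.Finite := by
  refine (finite_tent_periodic hk).finite_subsets.subset fun P hP x hx => ?_
  have h := (hP.eq_of_mem hx).1
  exact h ▸ iterate_minimalPeriod

lemma exists_isSmallestOrbitIn {A : Set 𝕀} {k : ℕ}
    (h : ∃ R, IsPeriodicOrbit tent k R ∧ R ⊆ A) : ∃ P, IsSmallestOrbitIn A k P := by
  obtain ⟨R, hR, hRA⟩ := h
  have hfin : {P | IsPeriodicOrbit tent k P ∧ P ⊆ A}.Finite :=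
    (finite_tent_orbits hR.1).subset fun P hP => hP.1
  obtain ⟨P, hP, hmin⟩ := hfin.exists_minimalFor diam _ ⟨R, hR, hRA⟩
  refine ⟨P, hP.1, hP.2, fun R' hR' hRA' => ?_⟩
  by_contra hlt
  exact hlt (hmin ⟨hR', hRA'⟩ (not_le.1 hlt).le)

lemma three_mem_periods_tent : 3 ∈ periods tent := by
  have h1 : tent ⟨2 / 7, by norm_num, by norm_num⟩ = ⟨4 / 7, by norm_num, by norm_num⟩ := by
    apply Subtype.ext
    simp only [tent]
    rw [abs_of_nonpos (by norm_num)]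
    norm_num
  have h2 : tent ⟨4 / 7, by norm_num, by norm_num⟩ = ⟨6 / 7, by norm_num, by norm_num⟩ := by
    apply Subtype.ext
    simp only [tent]
    rw [abs_of_nonneg (by norm_num)]
    norm_num
  have h3 : tent ⟨6 / 7, by norm_num, by norm_num⟩ = ⟨2 / 7, by norm_num, by norm_num⟩ := by
    apply Subtype.ext
    simp only [tent]
    rw [abs_of_nonneg (by norm_num)]
    norm_num
  have : Fact (Nat.Prime 3) := ⟨Nat.prime_three⟩
  refine ⟨by norm_num, ⟨2 / 7, by norm_num, by norm_num⟩, minimalPeriod_eq_prime ?_ ?_⟩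
  · rw [IsPeriodicPt, IsFixedPt]
    simp only [iterate_succ, iterate_zero, comp_apply, id, h1, h2, h3]
  · rw [IsFixedPt, h1]
    intro h
    have := congrArg Subtype.val h
    norm_num at this

lemma mem_periods_tent {k : ℕ} (hk : 0 < k) : k ∈ periods tent := by
  rcases precEq_three hk with rfl | h
  · exact three_mem_periods_tent
  · exact mem_periods_Icc_of_prec zero_le_one continuous_tent three_mem_periods_tent h

lemma exists_isSmallestOrbitIn_univ {k : ℕ} (hk : 0 < k) :
    ∃ P, IsSmallestOrbitIn univ k P :=
  exists_isSmallestOrbitIn ((exists_isPeriodicOrbit (mem_periods_tent hk)).imp fun _ h =>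
    ⟨h, subset_univ _⟩)

/-- The truncation of the tent map to the range of a shortest period-`k` orbit has exactly the
periods forced by `k`. -/
lemma periods_truncTent {k : ℕ} {P : Set 𝕀} (hP : IsSmallestOrbitIn univ k P) :
    periods (truncTent (sInf P) (sSup P)) = {n : ℕ | PrecEq k n} := by
  obtain ⟨hP, -, hmin⟩ := hP
  have hPt := hP.truncTent (subset_Icc_sInf_sSup P)
  ext n
  constructor
  · intro hn
    obtain ⟨R, hR⟩ := exists_isPeriodicOrbit hn
    rcases prec_or_eq_or_prec hP.1 hn.1 with h | h | h
    · exact Or.inr h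
    · exact Or.inl h
    · exfalso
      obtain ⟨hRt, hRP⟩ := hR.of_truncTent hP.sInf_le_sSup
        (fun hx => h.ne (hR.period_eq hPt hx hP.csInf_mem))
        (fun hx => h.ne (hR.period_eq hPt hx hP.csSup_mem))
      -- `R` lies strictly inside the hull of `P` and forces a period-`k` orbit strictly inside its
      -- own hull, shorter than `P`.
      obtain ⟨R', hR', hRR'⟩ := hRt.exists_subset_Ioo h
      have h1 := hR'.diam_lt hRR'
      have h2 := hRt.diam_lt hRP
      have h3 := hmin R' hR' (subset_univ _)
      unfold diam at *
      linarith
  · rintro (rfl | h)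
    · exact hPt.mem_periods
    · exact mem_periods_Icc_of_prec zero_le_one (continuous_truncTent _ _) hPt.mem_periods h

/-! ### The limiting truncation -/

lemma exists_isNestedChoice : ∃ Q, IsNestedChoice Q := by
  obtain ⟨Q₀, hQ₀⟩ := exists_isSmallestOrbitIn_univ (k := 3) (by norm_num)
  have hstep : ∀ (i : ℕ) (P : Set 𝕀), IsPeriodicOrbit tent (2 ^ i * 3) P →
      ∃ P', IsSmallestOrbitIn (Icc (sInf P) (sSup P)) (2 ^ (i + 1) * 3) P' := by
    intro i P hP
    refine exists_isSmallestOrbitIn ((hP.exists_subset_Ioo ?_).imp fun R hR =>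
      ⟨hR.1, hR.2.trans Ioo_subset_Icc_self⟩)
    rw [prec_iff (by decide) (by decide)]
    omega
  choose! F hF using hstep
  let Q : ℕ → Set 𝕀 := fun i => Nat.rec Q₀ (fun j P => F j P) i
  have hQ : ∀ i, IsPeriodicOrbit tent (2 ^ i * 3) (Q i) := by
    intro i
    induction i with
    | zero => rw [pow_zero, one_mul]; exact hQ₀.1
    | succ i ih => exact (hF i _ ih).1
  exact ⟨Q, hQ₀, fun i => hF i _ (hQ i)⟩

lemma IsNestedChoice.isPeriodicOrbit {Q : ℕ → Set 𝕀} (hQ : IsNestedChoice Q) (i : ℕ) :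
    IsPeriodicOrbit tent (2 ^ i * 3) (Q i) := by
  cases i with
  | zero => simpa using hQ.1.1
  | succ i => exact (hQ.2 i).1

lemma IsNestedChoice.monotone {Q : ℕ → Set 𝕀} (hQ : IsNestedChoice Q) :
    Monotone fun i => sInf (Q i) :=
  monotone_nat_of_le_succ fun i =>
    ((hQ.2 i).2.1 (hQ.isPeriodicOrbit (i + 1)).csInf_mem).1

lemma IsNestedChoice.antitone {Q : ℕ → Set 𝕀} (hQ : IsNestedChoice Q) :
    Antitone fun i => sSup (Q i) :=
  antitone_nat_of_succ_le fun i =>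
    ((hQ.2 i).2.1 (hQ.isPeriodicOrbit (i + 1)).csSup_mem).2

lemma IsNestedChoice.iSup_le_iInf {Q : ℕ → Set 𝕀} (hQ : IsNestedChoice Q) :
    (⨆ i, sInf (Q i)) ≤ ⨅ i, sSup (Q i) := by
  refine iSup_le fun i => le_iInf fun j => ?_
  calc sInf (Q i) ≤ sInf (Q (max i j)) := hQ.monotone (le_max_left i j)
    _ ≤ sSup (Q (max i j)) := (hQ.isPeriodicOrbit _).sInf_le_sSup
    _ ≤ sSup (Q j) := hQ.antitone (le_max_right i j)

lemma continuous_limTent (Q : ℕ → Set 𝕀) : Continuous (limTent Q) := continuous_truncTent _ _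

lemma two_pow_mem_periods_limTent {Q : ℕ → Set 𝕀} (hQ : IsNestedChoice Q) (j : ℕ) :
    2 ^ j ∈ periods (limTent Q) := by
  have hex : ∀ i, ∃ R, IsPeriodicOrbit tent (2 ^ j) R ∧ R ⊆ Ioo (sInf (Q i)) (sSup (Q i)) :=
    fun i => (hQ.isPeriodicOrbit i).exists_subset_Ioo (prec_two_pow (by decide) (by norm_num))
  choose R hR hRQ using hex
  have : Finite {P | IsPeriodicOrbit tent (2 ^ j) P} := finite_tent_orbits (by positivity)
  -- There are finitely many period-`2 ^ j` orbits, so one serves for infinitely many `i`; since the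
  -- hulls are nested, it lies in all of them.
  obtain ⟨⟨P, hP⟩, hinf⟩ := Finite.exists_infinite_fiber
    (fun i : ℕ => (⟨R i, hR i⟩ : {P | IsPeriodicOrbit tent (2 ^ j) P}))
  have hPQ : ∀ i, P ⊆ Icc (sInf (Q i)) (sSup (Q i)) := by
    intro i x hx
    obtain ⟨l, hl, hil⟩ := (infinite_coe_iff.1 hinf).exists_gt i
    have hRl : R l = P := congrArg Subtype.val hl
    have h := hRQ l (hRl ▸ hx)
    exact ⟨(hQ.monotone hil.le).trans h.1.le, h.2.le.trans (hQ.antitone hil.le)⟩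
  have hP' : IsPeriodicOrbit tent (2 ^ j) P := hP
  exact (hP'.truncTent fun x hx =>
    ⟨iSup_le fun i => (hPQ i hx).1, le_iInf fun i => (hPQ i hx).2⟩).mem_periods

lemma periods_limTent {Q : ℕ → Set 𝕀} (hQ : IsNestedChoice Q) :
    periods (limTent Q) = {n : ℕ | ∃ i : ℕ, n = 2 ^ i} := by
  ext n
  constructor
  swap
  · rintro ⟨j, rfl⟩
    exact two_pow_mem_periods_limTent hQ j
  intro hn
  by_contra hpow
  obtain ⟨a, p, hp, rfl⟩ := Nat.exists_eq_two_pow_mul_odd hn.1.ne'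
  have hp1 : 1 < p := by
    have h0 := hp.pos
    have h1 : p ≠ 1 := fun h => hpow ⟨a, by rw [h, mul_one]⟩
    omega
  have hle := hQ.iSup_le_iInf
  -- An orbit missing both heights would force a period-`2 ^ (b + 1) * 3` orbit strictly between
  -- them. It would lie in the hull of `Q b` and be shorter than `Q (b + 1)`.
  have hno : ∀ b, ∀ R, IsPeriodicOrbit (limTent Q) (2 ^ b * p) R →
      (⨆ i, sInf (Q i)) ∈ R ∨ (⨅ i, sSup (Q i)) ∈ R := by
    intro b R hR
    by_contra hcon
    push Not at hcon
    obtain ⟨hRt, hRI⟩ := hR.of_truncTent hle hcon.1 hcon.2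
    obtain ⟨R', hR', hRR'⟩ := hRt.exists_subset_Ioo (k := 2 ^ (b + 1) * 3)
      (by rw [prec_iff hp (by decide)]; omega)
    have hsub : R' ⊆ Ioo (⨆ i, sInf (Q i)) (⨅ i, sSup (Q i)) := fun x hx =>
      ⟨(hRI hRt.csInf_mem).1.trans (hRR' hx).1, (hRR' hx).2.trans (hRI hRt.csSup_mem).2⟩
    have h1 := (hQ.2 b).2.2 R' hR' fun x hx =>
      ⟨(le_iSup (fun i => sInf (Q i)) b).trans (hsub hx).1.le,
        (hsub hx).2.le.trans (iInf_le (fun i => sSup (Q i)) b)⟩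
    have h2 := hR'.diam_lt hsub
    have h3 : ((sInf (Q (b + 1)) : 𝕀) : ℝ) ≤ (⨆ i, sInf (Q i) : 𝕀) :=
      le_iSup (fun i => sInf (Q i)) (b + 1)
    have h4 : ((⨅ i, sSup (Q i) : 𝕀) : ℝ) ≤ (sSup (Q (b + 1)) : 𝕀) :=
      iInf_le (fun i => sSup (Q i)) (b + 1)
    unfold diam at *
    linarith
  have hdouble : ∀ b, a < b → 2 ^ b * p ∈ periods (limTent Q) := fun b hb =>
    mem_periods_Icc_of_prec zero_le_one (continuous_limTent Q) hn
      (by rw [prec_iff hp hp]; omega)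
  -- Three orbits of different periods are pairwise disjoint, yet each must contain one of the two
  -- heights.
  obtain ⟨R₁, hR₁⟩ := exists_isPeriodicOrbit hn
  obtain ⟨R₂, hR₂⟩ := exists_isPeriodicOrbit (hdouble (a + 1) (by omega))
  obtain ⟨R₃, hR₃⟩ := exists_isPeriodicOrbit (hdouble (a + 2) (by omega))
  have hinj : ∀ {b c : ℕ} {R R' : Set 𝕀}, b ≠ c → IsPeriodicOrbit (limTent Q) (2 ^ b * p) R →
      IsPeriodicOrbit (limTent Q) (2 ^ c * p) R' → ∀ x ∈ R, x ∉ R' :=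
    fun hbc h h' x hx hx' => hbc (two_pow_mul_odd_inj hp hp (h.period_eq h' hx hx')).1
  have h12 := hinj (by omega) hR₁ hR₂
  have h13 := hinj (by omega) hR₁ hR₃
  have h23 := hinj (by omega) hR₂ hR₃
  rcases hno _ _ hR₁ with h1 | h1 <;> rcases hno _ _ hR₂ with h2 | h2 <;>
    rcases hno _ _ hR₃ with h3 | h3
  all_goals first
    | exact h12 _ h1 h2
    | exact h13 _ h1 h3
    | exact h23 _ h2 h3

lemma exists_periods_eq {a b : ℝ} (hab : a < b) {S : Set ℕ} (hS : IsTail S) :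
    ∃ f : Icc a b → Icc a b, Continuous f ∧ periods f = S := by
  rcases hS.cases with ⟨k, hk, rfl⟩ | rfl
  · obtain ⟨P, hP⟩ := exists_isSmallestOrbitIn_univ hk
    rw [← periods_truncTent hP]
    exact exists_conj_Icc hab (continuous_truncTent _ _)
  · obtain ⟨Q, hQ⟩ := exists_isNestedChoice
    rw [← periods_limTent hQ]
    exact exists_conj_Icc hab (continuous_limTent Q)

/-- The numbers forced by `m` are exactly those after it, on every nondegenerate interval. -/
lemma forall_forces_iff_precEq {a b : ℝ} (hab : a < b) {m n : ℕ} (hm : 0 < m) :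
    (∀ f : Icc a b → Icc a b, Continuous f → m ∈ periods f → n ∈ periods f) ↔ PrecEq m n := by
  constructor
  · intro h
    -- The truncation at a shortest period-`m` orbit has no periods beyond those after `m`, so it
    -- refutes every other implication.
    obtain ⟨P, hP⟩ := exists_isSmallestOrbitIn_univ hm
    obtain ⟨f, hf, hper⟩ := exists_conj_Icc hab (continuous_truncTent (sInf P) (sSup P))
    rw [periods_truncTent hP] at hper
    have hn := h f hf (hper ▸ Or.inl rfl)
    rwa [hper] at hn
  · rintro (rfl | h) f hf hmem
    · exact hmem
    · exact mem_periods_Icc_of_prec hab.le hf hmem h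

end Sharkovsky
theorem theorem6 :
    -- a continuous self-map of a compact interval with a point of least period `m` has points
    -- of least period `n` for all `n` after `m`
    (∀ a b : ℝ, a ≤ b → ∀ f : Set.Icc a b → Set.Icc a b, Continuous f →
      ∀ m ∈ Sharkovsky.periods f, ∀ n : ℕ, Sharkovsky.Prec m n → n ∈ Sharkovsky.periods f) ∧
    -- and these (with `m` itself) are precisely the periods forced by `m`
    (∀ a b : ℝ, a < b → ∀ m n : ℕ, 0 < m → 0 < n →
      ((∀ f : Set.Icc a b → Set.Icc a b, Continuous f →
          m ∈ Sharkovsky.periods f → n ∈ Sharkovsky.periods f) ↔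
        Sharkovsky.PrecEq m n)) ∧
    -- every tail is the set of periods of a continuous map of the given interval
    (∀ a b : ℝ, a < b → ∀ S : Set ℕ, Sharkovsky.IsTail S →
      ∃ f : Set.Icc a b → Set.Icc a b, Continuous f ∧ Sharkovsky.periods f = S) ∧
    -- the truncated tent maps `T_k`
    (∀ k : ℕ, 0 < k →
      (∃ P, Sharkovsky.IsSmallestOrbitIn Set.univ k P) ∧
      ∀ P, Sharkovsky.IsSmallestOrbitIn Set.univ k P →
        Continuous (Sharkovsky.truncTent (sInf P) (sSup P)) ∧
        Sharkovsky.periods (Sharkovsky.truncTent (sInf P) (sSup P)) =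
          {n : ℕ | Sharkovsky.PrecEq k n}) ∧
    -- the limiting truncation `T_∞`
    ((∃ Q, Sharkovsky.IsNestedChoice Q) ∧
      ∀ Q, Sharkovsky.IsNestedChoice Q →
        Continuous (Sharkovsky.limTent Q) ∧
        Sharkovsky.periods (Sharkovsky.limTent Q) = {n : ℕ | ∃ i : ℕ, n = 2 ^ i}) := by
  refine ⟨fun a b hab f hf m hm n h => Sharkovsky.mem_periods_Icc_of_prec hab hf hm h,
    fun a b hab m n hm _ => Sharkovsky.forall_forces_iff_precEq hab hm,
    fun a b hab S hS => Sharkovsky.exists_periods_eq hab hS,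
    fun k hk => ⟨Sharkovsky.exists_isSmallestOrbitIn_univ hk, fun P hP =>
      ⟨Sharkovsky.continuous_truncTent _ _, Sharkovsky.periods_truncTent hP⟩⟩,
    Sharkovsky.exists_isNestedChoice, fun Q hQ =>
      ⟨Sharkovsky.continuous_limTent Q, Sharkovsky.periods_limTent hQ⟩⟩
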